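/- Let $\mathcal H$ and $\mathcal Y$ be Hilbert spaces over the same field, $\mathbb R$ or $\mathbb C$, let $A$ be the generator of a $C_0$-semigroup on $\mathcal H$, and let $C\in L(\mathcal H,\mathcal Y)$ be a bounded linear operator. An operator is called exponentially stable if it generates a $C_0$-semigroup $T(\cdot)$ on $\mathcal H$ with $T(\cdot)x\in L^2([0,\infty),\mathcal H)$ for each $x\in\mathcal H$, and the pair $(A,C)$ is called exponentially detectable if there exists $F\in L(\mathcal Y,\mathcal H)$ such that $A+FC$ (with domain $\operatorname{dom}A$) is exponentially stable. A self-adjoint $P\in L(\mathcal H)$ is called non-negative, written $P\ge 0$, if $\langle Px,x\rangle\ge 0$ for all $x\in\mathcal H$. For such $P$ consider the condition $$ \exists\,\eta,m>0\ \ \forall x\in\operatorname{dom}A:\qquad \|Cx\|^2-2\eta\,\mathrm{Re}\langle Ax,Px\rangle\ \ge\ m\|x\|^2. \qquad (\ast) $$ (1) If $(A,C)$ is exponentially detectable, then there exists a non-negative operator $P\in L(\mathcal H)$ such that $(\ast)$ holds. (2) Conversely, if $(\ast)$ holds for some non-negative $P\in L(\mathcal H)$ with $\operatorname{ran}C^*\subset\operatorname{ran}P$,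 then $(A,C)$ is exponentially detectable. -/

import Mathlib

open MeasureTheory Filter Topology

section

variable {𝕜 : Type*} [RCLike 𝕜] {H : Type*} [NormedAddCommGroup H] [InnerProductSpace 𝕜 H]
  {Y : Type*} [NormedAddCommGroup Y] [InnerProductSpace 𝕜 Y]

/-- A `C₀`-semigroup `(T t)` of bounded operators, `t ≥ 0`. The values of `T` at negative times
are irrelevant. -/
structure IsC0Semigroup (T : ℝ → H →L[𝕜] H) : Prop where
  map_zero : T 0 = ContinuousLinearMap.id 𝕜 H
  map_add : ∀ s t : ℝ, 0 ≤ s → 0 ≤ t → T (s + t) = (T s).comp (T t)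
  strongly_continuous : ∀ x : H, Tendsto (fun t : ℝ => T t x) (𝓝[>] 0) (𝓝 x)

/-- `A` is the infinitesimal generator of `T`: we have `x ∈ dom A` and `A x = y` exactly when
`(T t x - x) / t` tends to `y` as `t ↓ 0`. In particular, `dom A` consists of all `x` for which
this limit exists. -/
def IsInfinitesimalGenerator (A : H →ₗ.[𝕜] H) (T : ℝ → H →L[𝕜] H) : Prop :=
  ∀ x y : H, (x, y) ∈ A.graph ↔
    Tendsto (fun t : ℝ => ((t⁻¹ : ℝ) : 𝕜) • (T t x - x)) (𝓝[>] 0) (𝓝 y)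

/-- `A` generates a `C₀`-semigroup. -/
def GeneratesC0Semigroup (A : H →ₗ.[𝕜] H) : Prop :=
  ∃ T : ℝ → H →L[𝕜] H, IsC0Semigroup T ∧ IsInfinitesimalGenerator A T

/-- `A` is exponentially stable: it generates a `C₀`-semigroup `T` with
`T(·)x ∈ L²([0, ∞), H)` for every `x`. -/
def IsExponentiallyStable (A : H →ₗ.[𝕜] H) : Prop :=
  ∃ T : ℝ → H →L[𝕜] H, IsC0Semigroup T ∧ IsInfinitesimalGenerator A T ∧
    ∀ x : H, MemLp (fun t : ℝ => T t x) 2 (volume.restrict (Set.Ici (0 : ℝ)))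

/-- `(A, C)` is exponentially detectable: `A + F C`, with domain `dom A`, is exponentially stable
for some bounded `F`. -/
def IsExponentiallyDetectable (A : H →ₗ.[𝕜] H) (C : H →L[𝕜] Y) : Prop :=
  ∃ F : Y →L[𝕜] H, IsExponentiallyStable (((F.comp C : H →L[𝕜] H) : H →ₗ[𝕜] H) +ᵥ A)

/-- The Lyapunov-like form inequality: for some `η, m > 0`,
`‖C x‖² - 2 η Re ⟨A x, P x⟩ ≥ m ‖x‖²` for all `x ∈ dom A`. -/
def LyapunovFormInequality (A : H →ₗ.[𝕜] H) (C : H →L[𝕜] Y) (P : H →L[𝕜] H) : Prop :=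
  ∃ η m : ℝ, 0 < η ∧ 0 < m ∧ ∀ x : A.domain,
    m * ‖(x : H)‖ ^ 2 ≤ ‖C (x : H)‖ ^ 2 - 2 * η * RCLike.re (inner 𝕜 (A x) (P (x : H)))

end

/-!
Bounded perturbations of a generator `A` of a semigroup `T` are generators: after multiplication
with a decaying exponential, the Volterra operator `u ↦ T ∗ (B u)` is a contraction on bounded
continuous functions, so that Duhamel's equation `S(t) x = T(t) x + (T ∗ B S x)(t)` has a unique
solution, and differentiating it at `0` shows that `S` is generated by `B + A`.

If `A + F C` is exponentially stable with semigroup `S`, then `P = ∫₀^∞ S(t)* S(t) dt` is bounded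
and solves `2 Re ⟨(A + F C) x, P x⟩ = -‖x‖²`. The cross term `Re ⟨F C x, P x⟩` is at least
`-‖F‖ ‖P‖ ‖C x‖ ‖x‖`, and for small `η` it is absorbed into `‖C x‖²` by completing the square.

Conversely, `ran C* ⊆ ran P` gives `C* = P G` with `G` bounded, and for `F = -G / (2 η)` the form
inequality becomes `2 Re ⟨(A + F C) x, P x⟩ ≤ -(m / η) ‖x‖²`. Hence `⟨P u, u⟩` decreases along
orbits `u` starting in the domain at a rate that bounds their `L²` norm, and density of the domain
extends this bound to all orbits.
-/

open scoped NNReal BoundedContinuousFunction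

section Analysis

theorem tendsto_clm_apply_of_eventually_norm_le {𝕜 E F α : Type*} [NontriviallyNormedField 𝕜]
    [SeminormedAddCommGroup E] [NormedSpace 𝕜 E] [SeminormedAddCommGroup F] [NormedSpace 𝕜 F]
    {l : Filter α} {T : α → E →L[𝕜] F} {K : ℝ} (hT : ∀ᶠ a in l, ‖T a‖ ≤ K) {y : α → E} {x : E}
    {z : F} (hy : Tendsto y l (𝓝 x)) (hx : Tendsto (fun a => T a x) l (𝓝 z)) :
    Tendsto (fun a => T a (y a)) l (𝓝 z) := by
  have hsub : Tendsto (fun a => T a (y a - x)) l (𝓝 0) := by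
    refine squeeze_zero_norm' (hT.mono fun a ha => (T a).le_of_opNorm_le ha _) ?_
    simpa using (tendsto_iff_norm_sub_tendsto_zero.mp hy).const_mul K
  simpa using hsub.add hx

theorem hasDerivAt_intervalIntegral_diagonal {E : Type*} [NormedAddCommGroup E] [NormedSpace ℝ E]
    [CompleteSpace E] {g : ℝ → ℝ → E} (hg : Continuous (Function.uncurry g)) :
    HasDerivAt (fun t => ∫ s in (0 : ℝ)..t, g t s) (g 0 0) 0 := by
  have hscale : ∀ t, ∫ s in (0 : ℝ)..t, g t s = t • ∫ r in (0 : ℝ)..1, g t (t * r) := fun t => by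
    rw [intervalIntegral.smul_integral_comp_mul_left, mul_zero, mul_one]
  have hcont : Continuous fun t => ∫ r in (0 : ℝ)..1, g t (t * r) :=
    intervalIntegral.continuous_parametric_intervalIntegral_of_continuous'
      (f := fun t r => g t (t * r))
      (hg.comp (by fun_prop : Continuous fun p : ℝ × ℝ => (p.1, p.1 * p.2))) 0 1
  rw [hasDerivAt_iff_tendsto_slope_zero]
  have hlim := (hcont.tendsto 0).mono_left (nhdsWithin_le_nhds (s := {0}ᶜ))
  simp only [zero_mul, intervalIntegral.integral_const, sub_zero, one_smul] at hlim
  refine hlim.congr' (eventually_mem_nhdsWithin.mono fun t ht => ?_)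
  have ht : t ≠ 0 := ht
  simp only [hscale, zero_add, zero_smul, sub_zero, inv_smul_smul₀ ht]

theorem eq_inverse_one_sub_apply_iff {𝕜 E : Type*} [NontriviallyNormedField 𝕜]
    [NormedAddCommGroup E] [NormedSpace 𝕜 E] [CompleteSpace E] {Φ : E →L[𝕜] E} (hΦ : ‖Φ‖ < 1)
    {u v : E} : v = Ring.inverse (1 - Φ) u ↔ v = u + Φ v := by
  have hunit : IsUnit (1 - Φ) := isUnit_one_sub_of_norm_lt_one hΦ
  have hleft (w : E) : Ring.inverse (1 - Φ) ((1 - Φ) w) = w :=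
    DFunLike.congr_fun (Ring.inverse_mul_cancel _ hunit) w
  have hright (w : E) : (1 - Φ) (Ring.inverse (1 - Φ) w) = w :=
    DFunLike.congr_fun (Ring.mul_inverse_cancel _ hunit) w
  rw [← sub_eq_iff_eq_add]
  change _ ↔ (1 - Φ) v = u
  constructor
  · rintro rfl
    exact hright u
  · rintro rfl
    exact (hleft v).symm

theorem mem_graph_vadd_iff {R E F : Type*} [Ring R] [AddCommGroup E] [Module R E]
    [AddCommGroup F] [Module R F] (B : E →ₗ[R] F) (A : E →ₗ.[R] F) {x : E} {y : F} :
    (x, y) ∈ (B +ᵥ A).graph ↔ (x, y - B x) ∈ A.graph := by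
  simp only [LinearPMap.mem_graph_iff]
  constructor
  · rintro ⟨z, rfl, rfl⟩
    exact ⟨z, rfl, by simp [LinearPMap.vadd_apply]⟩
  · rintro ⟨z, rfl, hz⟩
    exact ⟨z, rfl, by simp [LinearPMap.vadd_apply, hz]⟩

section Factorization

variable {𝕜 E F Y : Type*} [NormedAddCommGroup F] [NormedAddCommGroup E] [CompleteSpace E]
  [NormedAddCommGroup Y] [CompleteSpace Y]

theorem exists_eq_comp_of_range_subset_of_injective [NontriviallyNormedField 𝕜] [NormedSpace 𝕜 E]
    [NormedSpace 𝕜 F] [NormedSpace 𝕜 Y] {D : Y →L[𝕜] F} {P : E →L[𝕜] F}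
    (hP : Function.Injective P) (h : Set.range D ⊆ Set.range P) :
    ∃ G : Y →L[𝕜] E, D = P.comp G := by
  choose g hg using fun y => h ⟨y, rfl⟩
  let G : Y →ₗ[𝕜] E :=
    { toFun := g
      map_add' := fun x y => hP (by simp only [hg, map_add])
      map_smul' := fun c x => hP (by simp only [hg, map_smul, RingHom.id_apply]) }
  have hG : Continuous G := G.continuous_of_seq_closed_graph fun u x y hu hGu => by
    have hD : Tendsto (fun n => D (u n)) atTop (𝓝 (P y)) := by
      simpa only [Function.comp_def, G, LinearMap.coe_mk, AddHom.coe_mk, hg]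
        using (P.continuous.tendsto y).comp hGu
    exact hP ((tendsto_nhds_unique hD ((D.continuous.tendsto x).comp hu)).trans (hg x).symm)
  exact ⟨⟨G, hG⟩, by ext y; exact (hg y).symm⟩

theorem exists_eq_comp_of_range_subset [RCLike 𝕜] [InnerProductSpace 𝕜 E] [NormedSpace 𝕜 F]
    [NormedSpace 𝕜 Y] {D : Y →L[𝕜] F} {P : E →L[𝕜] F} (h : Set.range D ⊆ Set.range P) :
    ∃ G : Y →L[𝕜] E, D = P.comp G := by
  let K : Submodule 𝕜 E := LinearMap.ker (P : E →ₗ[𝕜] F)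
  have : CompleteSpace K := P.isClosed_ker.completeSpace_coe
  let Q : Kᗮ →L[𝕜] F := P.comp Kᗮ.subtypeL
  have hQ : Function.Injective Q := (injective_iff_map_eq_zero Q).mpr fun z hz =>
    Subtype.ext (K.inf_orthogonal_eq_bot.le ⟨hz, z.2⟩)
  have hrange : Set.range P ⊆ Set.range Q := by
    rintro _ ⟨w, rfl⟩
    obtain ⟨a, ha, b, hb, rfl⟩ := K.exists_add_mem_mem_orthogonal w
    exact ⟨⟨b, hb⟩, by rw [map_add, show P a = 0 from ha, zero_add]; rfl⟩
  obtain ⟨G, rfl⟩ := exists_eq_comp_of_range_subset_of_injective hQ (h.trans hrange)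
  exact ⟨Kᗮ.subtypeL.comp G, rfl⟩

end Factorization

section PointwiseLp

open scoped ENNReal

variable {𝕜 E F α : Type*} [NormedAddCommGroup E] [CompleteSpace E] [NormedAddCommGroup F]
  [CompleteSpace F] {_ : MeasurableSpace α} {μ : Measure α}

/-- The bounded operator `x ↦ (a ↦ T a x)` into `Lp` attached to a family `T` of bounded operators
all of whose orbits are in `Lp`. Continuity is automatic, by the closed graph theorem. -/
noncomputable def orbitLp [NontriviallyNormedField 𝕜] [NormedSpace 𝕜 E] [NormedSpace 𝕜 F]
    {p : ℝ≥0∞} [Fact (1 ≤ p)] (T : α → E →L[𝕜] F) (hT : ∀ x, MemLp (fun a => T a x) p μ) :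
    E →L[𝕜] Lp F p μ :=
  .ofSeqClosedGraph
    (g :=
      { toFun := fun x => (hT x).toLp fun a => T a x
        map_add' := fun x y => by
          rw [← MemLp.toLp_add]
          exact MemLp.toLp_congr _ _ (Eventually.of_forall fun a => (T a).map_add x y)
        map_smul' := fun c x => by
          rw [RingHom.id_apply, ← MemLp.toLp_const_smul]
          exact MemLp.toLp_congr _ _ (Eventually.of_forall fun a => (T a).map_smul c x) })
    fun u x y hu hy => by
      obtain ⟨φ, hφ, hae⟩ := (tendstoInMeasure_of_tendsto_Lp hy).exists_seq_tendsto_ae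
      have horbits : ∀ᵐ a ∂μ, ∀ n, (hT (u n)).toLp (fun a => T a (u n)) a = T a (u n) :=
        ae_all_iff.mpr fun n => (hT (u n)).coeFn_toLp
      refine Lp.ext ?_
      filter_upwards [hae, horbits, (hT x).coeFn_toLp] with a ha hau hax
      have hlim : Tendsto (fun n => T a (u (φ n))) atTop (𝓝 (T a x)) :=
        ((T a).continuous.tendsto x).comp (hu.comp hφ.tendsto_atTop)
      exact (tendsto_nhds_unique (ha.congr fun n => hau (φ n)) hlim).trans hax.symm

variable [RCLike 𝕜] [InnerProductSpace 𝕜 E] [InnerProductSpace 𝕜 F]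

/-- The Gramian `∫ T(a)* T(a) dμ(a)` of a family `T` of bounded operators with orbits in `L²`; for a
semigroup on `[0, ∞)` this is the solution of Lyapunov's equation. -/
noncomputable def gramian (T : α → E →L[𝕜] F) (hT : ∀ x, MemLp (fun a => T a x) 2 μ) : E →L[𝕜] E :=
  (ContinuousLinearMap.adjoint (orbitLp T hT)).comp (orbitLp T hT)

theorem gramian_isPositive (T : α → E →L[𝕜] F) (hT : ∀ x, MemLp (fun a => T a x) 2 μ) :
    (gramian T hT).IsPositive :=
  ContinuousLinearMap.isPositive_adjoint_comp_self _

theorem re_inner_gramian_self (T : α → E →L[𝕜] F) (hT : ∀ x, MemLp (fun a => T a x) 2 μ) (x : E) :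
    RCLike.re (inner 𝕜 x (gramian T hT x)) = ∫ a, ‖T a x‖ ^ 2 ∂μ := by
  have hinner : inner 𝕜 x (gramian T hT x) = ∫ a, ((‖T a x‖ ^ 2 : ℝ) : 𝕜) ∂μ := by
    rw [gramian, ContinuousLinearMap.comp_apply, ContinuousLinearMap.adjoint_inner_right,
      L2.inner_def]
    refine integral_congr_ae ((hT x).coeFn_toLp.mono fun a ha => ?_)
    change inner 𝕜 ((hT x).toLp (fun a => T a x) a) ((hT x).toLp (fun a => T a x) a) = _
    rw [ha, inner_self_eq_norm_sq_to_K]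
    exact (RCLike.ofReal_pow _ _).symm
  rw [hinner, integral_ofReal, RCLike.ofReal_re]

end PointwiseLp

end Analysis

section Semigroup

variable {𝕜 : Type*} [RCLike 𝕜] {H : Type*} [NormedAddCommGroup H] [InnerProductSpace 𝕜 H]
  {T : ℝ → H →L[𝕜] H}

/-- The family `T` has growth bound `ω` with constant `M` on `[0, ∞)`. -/
def HasGrowthBound (T : ℝ → H →L[𝕜] H) (M ω : ℝ) : Prop :=
  ∀ t, 0 ≤ t → ‖T t‖ ≤ M * Real.exp (ω * t)

namespace HasGrowthBound

variable {M ω : ℝ}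

theorem nonneg (hb : HasGrowthBound T M ω) : 0 ≤ M := by
  simpa using (norm_nonneg _).trans (hb 0 le_rfl)

theorem norm_le_of_decay {ν : ℝ} (hb : HasGrowthBound T M (-ν)) (hν : 0 ≤ ν) {t : ℝ} (ht : 0 ≤ t) :
    ‖T t‖ ≤ M :=
  (hb t ht).trans (mul_le_of_le_one_right hb.nonneg
    (Real.exp_le_one_iff.mpr (by rw [neg_mul]; exact neg_nonpos.mpr (mul_nonneg hν ht))))

theorem exp_smul [NormedSpace ℝ H] [IsScalarTower ℝ 𝕜 H] (hb : HasGrowthBound T M ω)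
    (μ : ℝ) : HasGrowthBound (fun t => Real.exp (μ * t) • T t) M (ω + μ) := fun t ht => by
  rw [norm_smul, Real.norm_of_nonneg (Real.exp_nonneg _)]
  calc Real.exp (μ * t) * ‖T t‖ ≤ Real.exp (μ * t) * (M * Real.exp (ω * t)) := by
        gcongr
        exact hb t ht
    _ = M * Real.exp ((ω + μ) * t) := by
        rw [add_mul, Real.exp_add]
        ring

end HasGrowthBound

namespace IsC0Semigroup

theorem map_add_apply (hT : IsC0Semigroup T) {s t : ℝ} (hs : 0 ≤ s) (ht : 0 ≤ t) (x : H) :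
    T (s + t) x = T s (T t x) := by
  rw [hT.map_add s t hs ht, ContinuousLinearMap.comp_apply]

theorem map_natCast_mul (hT : IsC0Semigroup T) (n : ℕ) {t : ℝ} (ht : 0 ≤ t) :
    T (n * t) = T t ^ n := by
  induction n with
  | zero => simp [hT.map_zero, ContinuousLinearMap.one_def]
  | succ n ih =>
    rw [Nat.cast_succ, add_one_mul, hT.map_add _ _ (by positivity) ht, ih, pow_succ]
    rfl

theorem tendsto_nhdsGE (hT : IsC0Semigroup T) (x : H) :
    Tendsto (fun t : ℝ => T t x) (𝓝[≥] 0) (𝓝 x) := by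
  have h : ContinuousWithinAt (fun t : ℝ => T t x) (Set.Ioi 0) 0 := by
    simpa [ContinuousWithinAt, hT.map_zero] using hT.strongly_continuous x
  simpa [ContinuousWithinAt, hT.map_zero] using continuousWithinAt_Ioi_iff_Ici.mp h

theorem exists_norm_le_near_zero [CompleteSpace H] (hT : IsC0Semigroup T) :
    ∃ δ : ℝ, 0 < δ ∧ ∃ M : ℝ, 1 ≤ M ∧ ∀ t, 0 ≤ t → t ≤ δ → ‖T t‖ ≤ M := by
  by_contra! hcon
  choose t ht0 htn hbig using fun n : ℕ =>
    hcon _ (Nat.one_div_pos_of_nat (α := ℝ) (n := n)) ((n : ℝ) + 1) (by simp)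
  have htlim : Tendsto t atTop (𝓝[≥] 0) := tendsto_nhdsWithin_iff.mpr
    ⟨squeeze_zero ht0 htn tendsto_one_div_add_atTop_nhds_zero_nat, Eventually.of_forall ht0⟩
  obtain ⟨K, hK⟩ := banach_steinhaus (g := fun n => T (t n)) fun x => by
    obtain ⟨K, hK⟩ := ((hT.tendsto_nhdsGE x).comp htlim).norm.bddAbove_range
    exact ⟨K, fun n => hK ⟨n, rfl⟩⟩
  obtain ⟨n, hn⟩ := exists_nat_gt K
  linarith [hK n, hbig n]

theorem exists_hasGrowthBound [CompleteSpace H] (hT : IsC0Semigroup T) :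
    ∃ M ω : ℝ, HasGrowthBound T M ω := by
  obtain ⟨δ, hδ, M, hM, hb⟩ := hT.exists_norm_le_near_zero
  have hM0 : 0 < M := by linarith
  refine ⟨M, Real.log M / δ, fun t ht => ?_⟩
  set n := ⌊t / δ⌋₊
  have htn : t / (n + 1 : ℕ) ≤ δ := by
    rw [div_le_iff₀ (by positivity), ← div_le_iff₀' hδ]
    exact_mod_cast (Nat.lt_floor_add_one (t / δ)).le
  calc ‖T t‖ = ‖T (t / (n + 1 : ℕ)) ^ (n + 1)‖ := by
        rw [← hT.map_natCast_mul _ (by positivity), mul_div_cancel₀ _ (by positivity)]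
    _ ≤ M ^ (n + 1) := (norm_pow_le' _ n.succ_pos).trans (by
        gcongr
        exact hb _ (by positivity) htn)
    _ = M * Real.exp (Real.log M * n) := by
        rw [pow_succ', Real.exp_mul, Real.exp_log hM0, Real.rpow_natCast]
    _ ≤ M * Real.exp (Real.log M * (t / δ)) := by
        gcongr
        · exact Real.log_nonneg hM
        · exact Nat.floor_le (by positivity)
    _ = M * Real.exp (Real.log M / δ * t) := by ring_nf

theorem norm_sub_le (hT : IsC0Semigroup T) {s t : ℝ} (hs : 0 ≤ s) (ht : 0 ≤ t) (x : H) :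
    ‖T s x - T t x‖ ≤ ‖T (min s t)‖ * ‖T |s - t| x - x‖ := by
  wlog hst : t ≤ s generalizing s t
  · rw [norm_sub_rev, min_comm, abs_sub_comm]
    exact this ht hs (le_of_not_ge hst)
  have hs_eq : T s x = T t (T (s - t) x) := by
    rw [← hT.map_add_apply ht (sub_nonneg.mpr hst), add_sub_cancel]
  rw [abs_of_nonneg (sub_nonneg.mpr hst), min_eq_right hst, hs_eq, ← map_sub]
  exact (T t).le_opNorm _

theorem continuous_orbit [CompleteSpace H] (hT : IsC0Semigroup T) (x : H) :
    Continuous fun t : ℝ≥0 => T t x := by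
  obtain ⟨M, ω, hb⟩ := hT.exists_hasGrowthBound
  refine continuous_iff_continuousAt.mpr fun t => tendsto_iff_norm_sub_tendsto_zero.mpr ?_
  have hsmall : Tendsto (fun s : ℝ≥0 => ‖T |(s : ℝ) - t| x - x‖) (𝓝 t) (𝓝 0) := by
    refine tendsto_iff_norm_sub_tendsto_zero.mp ((hT.tendsto_nhdsGE x).comp
      (tendsto_nhdsWithin_iff.mpr
        ⟨?_, Eventually.of_forall fun s => Set.mem_Ici.mpr (abs_nonneg _)⟩))
    simpa using (by fun_prop : Continuous fun s : ℝ≥0 => |(s : ℝ) - t|).tendsto t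
  have hexp : Continuous fun s : ℝ≥0 => M * Real.exp (ω * min (s : ℝ) t) := by fun_prop
  refine squeeze_zero (fun s => norm_nonneg _) (fun s => ?_)
    (by simpa using (hexp.tendsto t).mul hsmall)
  exact (hT.norm_sub_le s.2 t.2 x).trans
    (mul_le_mul_of_nonneg_right (hb _ (le_min s.2 t.2)) (norm_nonneg _))

theorem continuous_uncurry [CompleteSpace H] (hT : IsC0Semigroup T) :
    Continuous fun p : ℝ≥0 × H => T p.1 p.2 := by
  obtain ⟨M, ω, hb⟩ := hT.exists_hasGrowthBound
  refine continuous_iff_continuousAt.mpr fun ⟨t, x⟩ => ?_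
  have hexp : Continuous fun p : ℝ≥0 × H => M * Real.exp (ω * p.1) := by fun_prop
  refine tendsto_clm_apply_of_eventually_norm_le (K := M * Real.exp (ω * t) + 1) ?_
    (continuous_snd.tendsto (t, x)) (((hT.continuous_orbit x).tendsto t).comp
      (continuous_fst.tendsto (t, x)))
  filter_upwards [(hexp.tendsto (t, x)).eventually_le_const (lt_add_one _)] with p hp
  exact (hb p.1 p.1.2).trans hp

theorem continuousOn_orbit [CompleteSpace H] (hT : IsC0Semigroup T) (x : H) :
    ContinuousOn (fun t : ℝ => T t x) (Set.Ici 0) :=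
  ((hT.continuous_orbit x).comp continuous_real_toNNReal).continuousOn.congr fun t ht => by
    simp only [Function.comp_apply, Real.coe_toNNReal t ht]

theorem continuous_conv_integrand [CompleteSpace H] {f : ℝ → H} (hT : IsC0Semigroup T)
    (hf : ContinuousOn f (Set.Ici 0)) :
    Continuous fun p : ℝ × ℝ => T (p.1 - p.2).toNNReal (f p.2.toNNReal) := by
  have hf' : Continuous fun s : ℝ => f s.toNNReal :=
    hf.comp_continuous (by fun_prop) fun s => NNReal.coe_nonneg _
  exact hT.continuous_uncurry.comp
    ((by fun_prop : Continuous fun p : ℝ × ℝ => (p.1 - p.2).toNNReal).prodMk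
      (hf'.comp continuous_snd))

theorem intervalIntegrable_conv [CompleteSpace H] {f : ℝ → H} (hT : IsC0Semigroup T)
    (hf : ContinuousOn f (Set.Ici 0)) {a b t : ℝ} (ha : 0 ≤ a) (hab : a ≤ b) (hbt : b ≤ t) :
    IntervalIntegrable (fun s => T (t - s) (f s)) volume a b := by
  refine ContinuousOn.intervalIntegrable_of_Icc hab
    (((hT.continuous_conv_integrand hf).comp (Continuous.prodMk_right t)).continuousOn.congr ?_)
  intro s hs
  simp only [Function.comp_apply, Real.coe_toNNReal s (ha.trans hs.1),
    Real.coe_toNNReal (t - s) (sub_nonneg.mpr (hs.2.trans hbt))]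

theorem exp_smul [NormedSpace ℝ H] [IsScalarTower ℝ 𝕜 H] (hT : IsC0Semigroup T) (μ : ℝ) :
    IsC0Semigroup fun t => Real.exp (μ * t) • T t where
  map_zero := by simp [hT.map_zero]
  map_add s t hs ht := by
    ext x
    simp [hT.map_add_apply hs ht, mul_add, Real.exp_add, smul_smul, mul_comm]
  strongly_continuous x := by
    have hexp : Tendsto (fun t : ℝ => Real.exp (μ * t)) (𝓝[>] 0) (𝓝 1) := by
      simpa using ((by fun_prop : Continuous fun t : ℝ => Real.exp (μ * t)).tendsto 0).mono_left
        nhdsWithin_le_nhds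
    simpa using hexp.smul (hT.strongly_continuous x)

end IsC0Semigroup

section Convolution

variable [NormedSpace ℝ H]

/-- The convolution `(T ∗ f)(t) = ∫₀ᵗ T(t - s) f(s) ds`, which is the mild solution of
`u' = A u + f`, `u(0) = 0` when `A` generates `T`. It is meaningful for `t ≥ 0` only. -/
noncomputable def semigroupConv (T : ℝ → H →L[𝕜] H) (f : ℝ → H) (t : ℝ) : H :=
  ∫ s in (0 : ℝ)..t, T (t - s) (f s)

theorem semigroupConv_congr {f g : ℝ → H} {t : ℝ} (ht : 0 ≤ t)
    (hfg : Set.EqOn f g (Set.Icc 0 t)) :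
    semigroupConv T f t = semigroupConv T g t := by
  refine intervalIntegral.integral_congr fun s hs => ?_
  rw [Set.uIcc_of_le ht] at hs
  exact congrArg (T (t - s)) (hfg hs)

theorem semigroupConv_eq_integral_toNNReal (T : ℝ → H →L[𝕜] H) (f : ℝ → H) {t : ℝ} (ht : 0 ≤ t) :
    semigroupConv T f t = ∫ s in (0 : ℝ)..t, T (t - s).toNNReal (f s.toNNReal) := by
  refine intervalIntegral.integral_congr fun s hs => ?_
  rw [Set.uIcc_of_le ht] at hs
  simp only [Real.coe_toNNReal s hs.1, Real.coe_toNNReal (t - s) (sub_nonneg.mpr hs.2)]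

theorem semigroupConv_const_smul [SMulCommClass ℝ 𝕜 H] (T : ℝ → H →L[𝕜] H) (c : 𝕜) (f : ℝ → H)
    (t : ℝ) : semigroupConv T (fun s => c • f s) t = c • semigroupConv T f t := by
  simp only [semigroupConv, map_smul, intervalIntegral.integral_smul]

theorem semigroupConv_exp_smul [IsScalarTower ℝ 𝕜 H] (T : ℝ → H →L[𝕜] H) (f : ℝ → H) (μ t : ℝ) :
    semigroupConv (fun t => Real.exp (μ * t) • T t) (fun t => Real.exp (μ * t) • f t) t =
      Real.exp (μ * t) • semigroupConv T f t := by
  simp only [semigroupConv, ← intervalIntegral.integral_smul]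
  congr 1 with s
  simp only [_root_.smul_apply, ContinuousLinearMap.map_smul_of_tower, smul_smul, ← Real.exp_add]
  ring_nf

namespace IsC0Semigroup

variable [CompleteSpace H] {f : ℝ → H}

theorem semigroupConv_add (hT : IsC0Semigroup T) {g : ℝ → H} (hf : ContinuousOn f (Set.Ici 0))
    (hg : ContinuousOn g (Set.Ici 0)) {t : ℝ} (ht : 0 ≤ t) :
    semigroupConv T (fun s => f s + g s) t = semigroupConv T f t + semigroupConv T g t := by
  simp only [semigroupConv, _root_.map_add]
  exact intervalIntegral.integral_add (hT.intervalIntegrable_conv hf le_rfl ht le_rfl)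
    (hT.intervalIntegrable_conv hg le_rfl ht le_rfl)

theorem continuousOn_semigroupConv (hT : IsC0Semigroup T) (hf : ContinuousOn f (Set.Ici 0)) :
    ContinuousOn (semigroupConv T f) (Set.Ici 0) :=
  (intervalIntegral.continuous_parametric_intervalIntegral_of_continuous (a₀ := 0)
    (f := fun t s => T (t - s).toNNReal (f s.toNNReal)) (hT.continuous_conv_integrand hf)
    continuous_id).continuousOn.congr fun _ ht => semigroupConv_eq_integral_toNNReal T f ht

theorem hasDerivWithinAt_semigroupConv_zero (hT : IsC0Semigroup T)
    (hf : ContinuousOn f (Set.Ici 0)) :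
    HasDerivWithinAt (semigroupConv T f) (f 0) (Set.Ici 0) 0 := by
  have h := hasDerivAt_intervalIntegral_diagonal
    (g := fun t s => T (t - s).toNNReal (f s.toNNReal)) (hT.continuous_conv_integrand hf)
  simp only [sub_zero, Real.toNNReal_zero, NNReal.coe_zero, hT.map_zero,
    ContinuousLinearMap.id_apply] at h
  exact h.hasDerivWithinAt.congr_of_mem
    (fun _ ht => semigroupConv_eq_integral_toNNReal T f ht) Set.self_mem_Ici

theorem semigroupConv_add_time [IsScalarTower ℝ 𝕜 H] (hT : IsC0Semigroup T)
    (hf : ContinuousOn f (Set.Ici 0)) {t r : ℝ} (ht : 0 ≤ t) (hr : 0 ≤ r) :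
    semigroupConv T f (t + r) =
      T t (semigroupConv T f r) + semigroupConv T (fun s => f (s + r)) t := by
  have hpast : ∫ s in (0 : ℝ)..r, T (t + r - s) (f s) = T t (semigroupConv T f r) := by
    have hcomm := ((T t).restrictScalars ℝ).intervalIntegral_comp_comm
      (hT.intervalIntegrable_conv hf le_rfl hr le_rfl)
    refine (intervalIntegral.integral_congr fun s hs => ?_).trans hcomm
    rw [Set.uIcc_of_le hr] at hs
    rw [add_sub_assoc, hT.map_add_apply ht (sub_nonneg.mpr hs.2)]
    rfl
  have hpresent : ∫ s in r..(t + r), T (t + r - s) (f s) =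
      semigroupConv T (fun s => f (s + r)) t := by
    simpa only [semigroupConv, add_sub_add_right_eq_sub, zero_add] using
      (intervalIntegral.integral_comp_add_right (a := 0) (b := t)
        (fun s => T (t + r - s) (f s)) r).symm
  rw [← hpast, ← hpresent]
  exact (intervalIntegral.integral_add_adjacent_intervals
    (hT.intervalIntegrable_conv hf le_rfl hr (by linarith))
    (hT.intervalIntegrable_conv hf hr (by linarith) le_rfl)).symm

end IsC0Semigroup

end Convolution

end Semigroup

section Perturbation

variable {𝕜 : Type*} [RCLike 𝕜] {H : Type*} [NormedAddCommGroup H] [InnerProductSpace 𝕜 H]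
  {T S : ℝ → H →L[𝕜] H} {M ν : ℝ}

theorem integral_exp_neg_mul_sub_le (hν : 0 < ν) (t : ℝ) :
    ∫ s in (0 : ℝ)..t, Real.exp (-ν * (t - s)) ≤ 1 / ν := by
  have hderiv (s : ℝ) :
      HasDerivAt (fun s : ℝ => Real.exp (-ν * (t - s)) / ν) (Real.exp (-ν * (t - s))) s := by
    have hlin : HasDerivAt (fun s : ℝ => -ν * (t - s)) ν s := by
      simpa using ((hasDerivAt_id s).const_sub t).const_mul (-ν)
    simpa only [mul_div_cancel_right₀ _ hν.ne'] using hlin.exp.div_const ν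
  rw [intervalIntegral.integral_eq_sub_of_hasDerivAt (fun s _ => hderiv s)
    (Continuous.intervalIntegrable (by fun_prop) _ _), sub_self, mul_zero, Real.exp_zero]
  exact sub_le_self _ (by positivity)

/-- The operator that sends `x` to its orbit `t ↦ T(t)x`, for a bounded semigroup. -/
noncomputable def boundedOrbit [CompleteSpace H] (hT : IsC0Semigroup T)
    (hb : ∀ t, 0 ≤ t → ‖T t‖ ≤ M) : H →L[𝕜] (ℝ≥0 →ᵇ H) :=
  LinearMap.mkContinuousOfExistsBound
    { toFun x := .ofNormedAddCommGroup (fun t : ℝ≥0 => T t x) (hT.continuous_orbit x) (M * ‖x‖)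
        fun t => (T t).le_of_opNorm_le (hb t t.2) x
      map_add' x y := by ext t; exact (T t).map_add x y
      map_smul' c x := by ext t; exact (T t).map_smul c x }
    ⟨M, fun x => (BoundedContinuousFunction.norm_le
      (mul_nonneg ((norm_nonneg _).trans (hb 0 le_rfl)) (norm_nonneg x))).mpr
        fun t => (T t).le_of_opNorm_le (hb t t.2) x⟩

theorem continuousOn_comp_toNNReal (B : H →L[𝕜] H) (u : ℝ≥0 →ᵇ H) :
    ContinuousOn (fun s : ℝ => B (u s.toNNReal)) (Set.Ici 0) :=
  (by fun_prop : Continuous fun s : ℝ => B (u s.toNNReal)).continuousOn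

variable [NormedSpace ℝ H]

theorem norm_semigroupConv_le (hb : HasGrowthBound T M (-ν)) (hν : 0 < ν) {f : ℝ → H} {K t : ℝ}
    (hf : ∀ s, 0 ≤ s → ‖f s‖ ≤ K) (ht : 0 ≤ t) : ‖semigroupConv T f t‖ ≤ M * K / ν := by
  have hM : 0 ≤ M := hb.nonneg
  have hK : 0 ≤ K := (norm_nonneg _).trans (hf 0 le_rfl)
  calc ‖semigroupConv T f t‖ ≤ ∫ s in (0 : ℝ)..t, M * K * Real.exp (-ν * (t - s)) := by
        refine intervalIntegral.norm_integral_le_of_norm_le ht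
          (Eventually.of_forall fun s hs => ?_) (Continuous.intervalIntegrable (by fun_prop) _ _)
        calc ‖T (t - s) (f s)‖ ≤ ‖T (t - s)‖ * ‖f s‖ := (T (t - s)).le_opNorm _
          _ ≤ M * Real.exp (-ν * (t - s)) * K := by
              gcongr
              · exact hb _ (sub_nonneg.mpr hs.2)
              · exact hf s hs.1.le
          _ = M * K * Real.exp (-ν * (t - s)) := by ring
    _ ≤ M * K * (1 / ν) := by
        rw [intervalIntegral.integral_const_mul]
        gcongr
        exact integral_exp_neg_mul_sub_le hν t
    _ = M * K / ν := by ring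

theorem norm_semigroupConv_comp_toNNReal_le (hb : HasGrowthBound T M (-ν)) (hν : 0 < ν)
    (B : H →L[𝕜] H) (u : ℝ≥0 →ᵇ H) (t : ℝ≥0) :
    ‖semigroupConv T (fun s => B (u s.toNNReal)) t‖ ≤ M * ‖B‖ / ν * ‖u‖ :=
  (norm_semigroupConv_le hb hν (fun s _ => B.le_opNorm_of_le (u.norm_coe_le_norm s.toNNReal))
    t.2).trans_eq (by ring)

/-- `S` is the bounded perturbation of `T` by `B`, in the sense that the orbits of `S` satisfy
Duhamel's formula (variation of constants) `S(t)x = T(t)x + ∫₀ᵗ T(t - s) B S(s)x ds`. -/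
def IsDuhamelPerturbation (T : ℝ → H →L[𝕜] H) (B : H →L[𝕜] H) (S : ℝ → H →L[𝕜] H) : Prop :=
  ∀ t, 0 ≤ t → ∀ x, S t x = T t x + semigroupConv T (fun s => B (S s x)) t

variable [IsScalarTower ℝ 𝕜 H] {B : H →L[𝕜] H}

theorem IsDuhamelPerturbation.exp_smul (hS : IsDuhamelPerturbation T B S) (μ : ℝ) :
    IsDuhamelPerturbation (fun t => Real.exp (μ * t) • T t) B
      (fun t => Real.exp (μ * t) • S t) := fun t ht x => by
  simp only [_root_.smul_apply, ContinuousLinearMap.map_smul_of_tower, semigroupConv_exp_smul]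
  rw [hS t ht x, smul_add]

variable [CompleteSpace H]

/-- The Volterra operator `u ↦ T ∗ B u` on bounded continuous functions, for an exponentially
decaying semigroup `T`. -/
noncomputable def volterra (hT : IsC0Semigroup T) (hν : 0 < ν) (hb : HasGrowthBound T M (-ν))
    (B : H →L[𝕜] H) : (ℝ≥0 →ᵇ H) →L[𝕜] (ℝ≥0 →ᵇ H) :=
  LinearMap.mkContinuous
    { toFun u := .ofNormedAddCommGroup
        (fun t : ℝ≥0 => semigroupConv T (fun s => B (u s.toNNReal)) t)
        ((hT.continuousOn_semigroupConv (continuousOn_comp_toNNReal B u)).comp_continuous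
          NNReal.continuous_coe fun t => t.2) _ (norm_semigroupConv_comp_toNNReal_le hb hν B u)
      map_add' u v := by
        ext t
        exact (semigroupConv_congr t.2 fun s _ => B.map_add _ _).trans
          (hT.semigroupConv_add (continuousOn_comp_toNNReal B u)
            (continuousOn_comp_toNNReal B v) t.2)
      map_smul' c u := by
        ext t
        exact (semigroupConv_congr t.2 fun s _ => B.map_smul c _).trans
          (semigroupConv_const_smul T c _ t) }
    (M * ‖B‖ / ν) fun u => (BoundedContinuousFunction.norm_le
      (mul_nonneg (div_nonneg (mul_nonneg hb.nonneg (norm_nonneg B)) hν.le) (norm_nonneg u))).mpr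
        (norm_semigroupConv_comp_toNNReal_le hb hν B u)

theorem norm_volterra_le (hT : IsC0Semigroup T) (hν : 0 < ν) (hb : HasGrowthBound T M (-ν))
    (B : H →L[𝕜] H) : ‖volterra hT hν hb B‖ ≤ M * ‖B‖ / ν :=
  LinearMap.mkContinuous_norm_le _ (div_nonneg (mul_nonneg hb.nonneg (norm_nonneg B)) hν.le) _

/-- The translation `u ↦ u(· + r)` of bounded continuous functions on `[0, ∞)`. -/
noncomputable def timeShift (r : ℝ≥0) (u : ℝ≥0 →ᵇ H) : ℝ≥0 →ᵇ H :=
  u.compContinuous ⟨fun t => t + r, by fun_prop⟩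

theorem timeShift_eq_orbit_add_volterra (hT : IsC0Semigroup T) (hν : 0 < ν)
    (hb : HasGrowthBound T M (-ν)) (hM : ∀ t, 0 ≤ t → ‖T t‖ ≤ M) {u : ℝ≥0 →ᵇ H} {x : H}
    (hu : u = boundedOrbit hT hM x + volterra hT hν hb B u) (r : ℝ≥0) :
    timeShift r u = boundedOrbit hT hM (u r) + volterra hT hν hb B (timeShift r u) := by
  have hu' (t : ℝ≥0) : u t = T t x + semigroupConv T (fun s => B (u s.toNNReal)) t :=
    DFunLike.congr_fun hu t
  ext t
  change u (t + r) = T t (u r) + semigroupConv T (fun s => B (u (s.toNNReal + r))) t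
  have hshift : semigroupConv T (fun s => B (u (s + r).toNNReal)) t =
      semigroupConv T (fun s => B (u (s.toNNReal + r))) t :=
    semigroupConv_congr t.2 fun s hs => by
      simp only [Real.toNNReal_add hs.1 r.coe_nonneg, Real.toNNReal_coe]
  rw [hu', hu' r, NNReal.coe_add, hT.map_add_apply t.coe_nonneg r.coe_nonneg, map_add, ← hshift,
    add_assoc, hT.semigroupConv_add_time (continuousOn_comp_toNNReal B u) t.coe_nonneg r.coe_nonneg]

theorem exists_isDuhamelPerturbation_of_decay (hT : IsC0Semigroup T) (hν : 0 < ν)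
    (hb : HasGrowthBound T M (-ν)) (hB : M * ‖B‖ < ν) :
    ∃ S : ℝ → H →L[𝕜] H, IsC0Semigroup S ∧ IsDuhamelPerturbation T B S := by
  have hM (t : ℝ) (ht : 0 ≤ t) : ‖T t‖ ≤ M := hb.norm_le_of_decay hν.le ht
  set J := boundedOrbit hT hM
  set Φ := volterra hT hν hb B
  have hΦ : ‖Φ‖ < 1 := (norm_volterra_le hT hν hb B).trans_lt ((div_lt_one hν).mpr hB)
  let N : H →L[𝕜] (ℝ≥0 →ᵇ H) := (Ring.inverse (1 - Φ)).comp J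
  have hN (x : H) : N x = J x + Φ (N x) := (eq_inverse_one_sub_apply_iff hΦ).mp rfl
  let S (t : ℝ) : H →L[𝕜] H := (BoundedContinuousFunction.evalCLM 𝕜 t.toNNReal).comp N
  have hduhamel : IsDuhamelPerturbation T B S := fun t ht x => by
    have h : S t x = T t.toNNReal x + semigroupConv T (fun s => B (S s x)) t.toNNReal :=
      DFunLike.congr_fun (hN x) t.toNNReal
    rwa [Real.coe_toNNReal t ht] at h
  have hzero (x : H) : S 0 x = x := by
    simp [hduhamel 0 le_rfl x, hT.map_zero, semigroupConv]
  refine ⟨S, ⟨ContinuousLinearMap.ext hzero, fun s t hs ht => ?_, fun x => ?_⟩, hduhamel⟩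
  · ext x
    have hshift : timeShift t.toNNReal (N x) = N (S t x) :=
      (eq_inverse_one_sub_apply_iff hΦ).mpr
        (timeShift_eq_orbit_add_volterra hT hν hb hM (hN x) t.toNNReal)
    change N x (s + t).toNNReal = N (S t x) s.toNNReal
    rw [← hshift, Real.toNNReal_add hs ht]
    rfl
  · have hcont : Continuous fun t => S t x := (N x).continuous.comp continuous_real_toNNReal
    simpa only [hzero] using (hcont.tendsto 0).mono_left nhdsWithin_le_nhds

theorem IsC0Semigroup.exists_isDuhamelPerturbation (hT : IsC0Semigroup T) (B : H →L[𝕜] H) :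
    ∃ S : ℝ → H →L[𝕜] H, IsC0Semigroup S ∧ IsDuhamelPerturbation T B S := by
  obtain ⟨M, ω, hb⟩ := hT.exists_hasGrowthBound
  have hν : 0 < M * ‖B‖ + 1 := by linarith [mul_nonneg hb.nonneg (norm_nonneg B)]
  set ν := M * ‖B‖ + 1
  set μ := -(ω + ν)
  have hdecay := hb.exp_smul μ
  rw [show ω + μ = -ν by ring] at hdecay
  obtain ⟨S, hS, hTS⟩ :=
    exists_isDuhamelPerturbation_of_decay (hT.exp_smul μ) hν hdecay (lt_add_one _)
  refine ⟨_, hS.exp_smul (-μ), ?_⟩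
  simpa [smul_smul, ← Real.exp_add] using hTS.exp_smul (-μ)

end Perturbation

section Generator

variable {𝕜 : Type*} [RCLike 𝕜] {H : Type*} [NormedAddCommGroup H] [InnerProductSpace 𝕜 H]
  {T S : ℝ → H →L[𝕜] H} {B : H →L[𝕜] H} {A : H →ₗ.[𝕜] H}

theorem IsC0Semigroup.hasDerivWithinAt_zero_iff [NormedSpace ℝ H] [IsScalarTower ℝ 𝕜 H]
    (hT : IsC0Semigroup T) {x y : H} :
    HasDerivWithinAt (fun t : ℝ => T t x) y (Set.Ici 0) 0 ↔
      Tendsto (fun t : ℝ => ((t⁻¹ : ℝ) : 𝕜) • (T t x - x)) (𝓝[>] 0) (𝓝 y) := by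
  rw [← hasDerivWithinAt_Ioi_iff_Ici, hasDerivWithinAt_iff_tendsto_slope' Set.self_notMem_Ioi]
  refine tendsto_congr fun t => ?_
  rw [slope_def_module, sub_zero, hT.map_zero, ContinuousLinearMap.id_apply,
    RCLike.real_smul_eq_coe_smul (K := 𝕜)]

namespace IsInfinitesimalGenerator

variable [NormedSpace ℝ H] [IsScalarTower ℝ 𝕜 H] {x y : H}

theorem mem_graph_iff_hasDerivWithinAt (hA : IsInfinitesimalGenerator A T)
    (hT : IsC0Semigroup T) :
    (x, y) ∈ A.graph ↔ HasDerivWithinAt (fun t : ℝ => T t x) y (Set.Ici 0) 0 :=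
  (hA x y).trans hT.hasDerivWithinAt_zero_iff.symm

theorem map_mem_graph (hA : IsInfinitesimalGenerator A T) (hT : IsC0Semigroup T)
    (hxy : (x, y) ∈ A.graph) {t : ℝ} (ht : 0 ≤ t) : (T t x, T t y) ∈ A.graph := by
  rw [hA.mem_graph_iff_hasDerivWithinAt hT] at hxy ⊢
  refine (((T t).restrictScalars ℝ).hasFDerivAt.comp_hasDerivWithinAt 0 hxy).congr_of_mem
    (fun s hs => ?_) Set.self_mem_Ici
  have hcomm : T s (T t x) = T t (T s x) := by
    rw [← hT.map_add_apply hs ht, ← hT.map_add_apply ht hs, add_comm]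
  exact hcomm

theorem hasDerivWithinAt_orbit (hA : IsInfinitesimalGenerator A T) (hT : IsC0Semigroup T)
    (hxy : (x, y) ∈ A.graph) {t : ℝ} (ht : 0 ≤ t) :
    HasDerivWithinAt (fun s : ℝ => T s x) (T t y) (Set.Ici t) t := by
  have hzero : HasDerivWithinAt (fun s : ℝ => T s (T t x)) (T t y) (Set.Ici 0) (t - t) := by
    rw [sub_self]
    exact (hA.mem_graph_iff_hasDerivWithinAt hT).mp (hA.map_mem_graph hT hxy ht)
  have hshift := hzero.scomp (h := fun s => s - t) t
    ((hasDerivWithinAt_id t (Set.Ici t)).sub_const t)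
    fun s (hs : t ≤ s) => Set.mem_Ici.mpr (sub_nonneg.mpr hs)
  rw [one_smul] at hshift
  refine hshift.congr_of_mem (fun s hs => ?_) Set.self_mem_Ici
  simp only [Function.comp_apply, ← hT.map_add_apply (sub_nonneg.mpr hs) ht,
    sub_add_cancel]

theorem semigroupConv_const_mem_graph [CompleteSpace H] (hA : IsInfinitesimalGenerator A T)
    (hT : IsC0Semigroup T) (x : H) {t : ℝ} (ht : 0 ≤ t) :
    (semigroupConv T (fun _ => x) t, T t x - x) ∈ A.graph := by
  rw [hA.mem_graph_iff_hasDerivWithinAt hT]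
  have hu := hT.hasDerivWithinAt_semigroupConv_zero (continuousOn_const (c := x))
  have hTu := ((T t).restrictScalars ℝ).hasFDerivAt.comp_hasDerivWithinAt 0 hu
  refine ((hTu.sub hu).add_const (semigroupConv T (fun _ => x) t)).congr_of_mem
    (fun h hh => ?_) Set.self_mem_Ici
  have hcocycle : T t (semigroupConv T (fun _ => x) h) + semigroupConv T (fun _ => x) t =
      T h (semigroupConv T (fun _ => x) t) + semigroupConv T (fun _ => x) h := by
    rw [← hT.semigroupConv_add_time continuousOn_const ht hh, add_comm t h,
      hT.semigroupConv_add_time continuousOn_const hh ht]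
  exact (eq_sub_of_add_eq hcocycle.symm).trans (add_sub_right_comm _ _ _)

end IsInfinitesimalGenerator

theorem IsInfinitesimalGenerator.dense_domain [CompleteSpace H]
    (hA : IsInfinitesimalGenerator A T) (hT : IsC0Semigroup T) : Dense (A.domain : Set H) := by
  let : NormedSpace ℝ H := NormedSpace.restrictScalars ℝ 𝕜 H
  have : IsScalarTower ℝ 𝕜 H := .restrictScalars ℝ 𝕜 H
  intro x
  have hslope := (hasDerivWithinAt_iff_tendsto_slope' Set.self_notMem_Ioi).mp
    (hT.hasDerivWithinAt_semigroupConv_zero (continuousOn_const (c := x))).Ioi_of_Ici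
  refine mem_closure_of_tendsto hslope (eventually_mem_nhdsWithin.mono fun t ht => ?_)
  rw [slope_def_module, sub_zero, RCLike.real_smul_eq_coe_smul (K := 𝕜)]
  refine A.domain.smul_mem _ (A.domain.sub_mem ?_ ?_)
  · exact LinearPMap.mem_domain_of_mem_graph (hA.semigroupConv_const_mem_graph hT x ht.le)
  · exact LinearPMap.mem_domain_of_mem_graph (hA.semigroupConv_const_mem_graph hT x le_rfl)

theorem IsDuhamelPerturbation.isInfinitesimalGenerator [CompleteSpace H] [NormedSpace ℝ H]
    [IsScalarTower ℝ 𝕜 H] (hTS : IsDuhamelPerturbation T B S) (hT : IsC0Semigroup T)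
    (hS : IsC0Semigroup S) (hA : IsInfinitesimalGenerator A T) :
    IsInfinitesimalGenerator ((B : H →ₗ[𝕜] H) +ᵥ A) S := fun x y => by
  have hconv : HasDerivWithinAt (semigroupConv T fun s => B (S s x)) (B x) (Set.Ici 0) 0 := by
    simpa [hS.map_zero, Function.comp_def] using hT.hasDerivWithinAt_semigroupConv_zero
      (B.continuous.comp_continuousOn (hS.continuousOn_orbit x))
  rw [mem_graph_vadd_iff, hA.mem_graph_iff_hasDerivWithinAt hT, ← hS.hasDerivWithinAt_zero_iff]
  constructor <;> intro h
  · simpa using (h.add hconv).congr_of_mem (fun t ht => hTS t ht x) Set.self_mem_Ici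
  · exact (h.sub hconv).congr_of_mem (fun t ht => eq_sub_of_add_eq (hTS t ht x).symm)
      Set.self_mem_Ici

theorem GeneratesC0Semigroup.vadd [CompleteSpace H] (hA : GeneratesC0Semigroup A) (B : H →L[𝕜] H) :
    GeneratesC0Semigroup ((B : H →ₗ[𝕜] H) +ᵥ A) := by
  let : NormedSpace ℝ H := NormedSpace.restrictScalars ℝ 𝕜 H
  have : IsScalarTower ℝ 𝕜 H := .restrictScalars ℝ 𝕜 H
  obtain ⟨T, hT, hAT⟩ := hA
  obtain ⟨S, hS, hTS⟩ := hT.exists_isDuhamelPerturbation B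
  exact ⟨S, hS, hTS.isInfinitesimalGenerator hT hS hAT⟩

end Generator

section Lyapunov

variable {𝕜 : Type*} [RCLike 𝕜] {H : Type*} [NormedAddCommGroup H] [InnerProductSpace 𝕜 H]
  {T : ℝ → H →L[𝕜] H} {A : H →ₗ.[𝕜] H} {P : H →L[𝕜] H} {c : ℝ}

theorem hasDerivWithinAt_re_inner_of_isPositive [NormedSpace ℝ H] [IsScalarTower ℝ 𝕜 H]
    (hP : P.IsPositive) {u : ℝ → H} {u' : H} {s : Set ℝ} {t : ℝ}
    (hu : HasDerivWithinAt u u' s t) :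
    HasDerivWithinAt (fun t => RCLike.re (inner 𝕜 (u t) (P (u t))))
      (2 * RCLike.re (inner 𝕜 u' (P (u t)))) s t := by
  have hPu : HasDerivWithinAt (fun t => P (u t)) (P u') s t :=
    (P.restrictScalars ℝ).hasFDerivAt.comp_hasDerivWithinAt t hu
  have hre := (RCLike.reCLM (K := 𝕜)).hasFDerivAt.comp_hasDerivWithinAt t (hu.inner 𝕜 hPu)
  have hsymm : RCLike.re (inner 𝕜 (u t) (P u')) = RCLike.re (inner 𝕜 u' (P (u t))) := by
    rw [← hP.inner_left_eq_inner_right, inner_re_symm]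
  rwa [RCLike.reCLM_apply, map_add, hsymm, ← two_mul] at hre

section Dissipation

variable [CompleteSpace H] [NormedSpace ℝ H] [IsScalarTower ℝ 𝕜 H]

namespace IsInfinitesimalGenerator

theorem re_inner_orbit_add_integral_le_of_mem_domain (hA : IsInfinitesimalGenerator A T)
    (hT : IsC0Semigroup T) (hP : P.IsPositive)
    (hL : ∀ x : A.domain, 2 * RCLike.re (inner 𝕜 (A x) (P x)) ≤ -c * ‖(x : H)‖ ^ 2)
    {x : H} (hx : x ∈ A.domain) {t : ℝ} (ht : 0 ≤ t) :
    RCLike.re (inner 𝕜 (T t x) (P (T t x))) + c * ∫ s in (0 : ℝ)..t, ‖T s x‖ ^ 2 ≤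
      RCLike.re (inner 𝕜 x (P x)) := by
  have hxy : (x, A ⟨x, hx⟩) ∈ A.graph := A.mem_graph ⟨x, hx⟩
  have horbit : ContinuousOn (fun s => T s x) (Set.Icc 0 t) :=
    (hT.continuousOn_orbit x).mono Set.Icc_subset_Ici_self
  have hform : ContinuousOn (fun s => RCLike.re (inner 𝕜 (T s x) (P (T s x)))) (Set.Icc 0 t) :=
    RCLike.continuous_re.comp_continuousOn
      (horbit.inner (P.continuous.comp_continuousOn horbit))
  have hdecay := intervalIntegral.sub_le_integral_of_hasDeriv_right_of_le
    (φ := fun s => -c * ‖T s x‖ ^ 2) ht hform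
    (fun s hs => (hasDerivWithinAt_re_inner_of_isPositive hP
      (hA.hasDerivWithinAt_orbit hT hxy hs.1.le)).Ioi_of_Ici)
    (continuousOn_const.mul (horbit.norm.pow 2)).integrableOn_Icc
    (fun s hs => by
      obtain ⟨z, hz, hAz⟩ := (LinearPMap.mem_graph_iff A).mp (hA.map_mem_graph hT hxy hs.1.le)
      simpa only [hz, hAz] using hL z)
  rw [intervalIntegral.integral_const_mul, hT.map_zero, ContinuousLinearMap.id_apply] at hdecay
  linarith

theorem re_inner_orbit_add_integral_le (hA : IsInfinitesimalGenerator A T)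
    (hT : IsC0Semigroup T) (hP : P.IsPositive)
    (hL : ∀ x : A.domain, 2 * RCLike.re (inner 𝕜 (A x) (P x)) ≤ -c * ‖(x : H)‖ ^ 2)
    (x : H) {t : ℝ} (ht : 0 ≤ t) :
    RCLike.re (inner 𝕜 (T t x) (P (T t x))) + c * ∫ s in (0 : ℝ)..t, ‖T s x‖ ^ 2 ≤
      RCLike.re (inner 𝕜 x (P x)) := by
  have hintegral : Continuous fun x : H => ∫ s in (0 : ℝ)..t, ‖T s x‖ ^ 2 := by
    have huncurry : Continuous fun p : H × ℝ => ‖T p.2.toNNReal p.1‖ ^ 2 :=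
      (hT.continuous_uncurry.comp
        (by fun_prop : Continuous fun p : H × ℝ => (p.2.toNNReal, p.1))).norm.pow 2
    refine (intervalIntegral.continuous_parametric_intervalIntegral_of_continuous'
      (μ := volume) (f := fun (x : H) (s : ℝ) => ‖T s.toNNReal x‖ ^ 2) huncurry 0 t).congr
      fun x => intervalIntegral.integral_congr fun s hs => ?_
    rw [Set.uIcc_of_le ht] at hs
    simp only [Real.coe_toNNReal s hs.1]
  have hclosed : IsClosed {x : H | RCLike.re (inner 𝕜 (T t x) (P (T t x))) +
      c * ∫ s in (0 : ℝ)..t, ‖T s x‖ ^ 2 ≤ RCLike.re (inner 𝕜 x (P x))} :=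
    isClosed_le (by fun_prop) (by fun_prop)
  exact hclosed.closure_subset_iff.mpr
    (fun x hx => hA.re_inner_orbit_add_integral_le_of_mem_domain hT hP hL hx ht)
    (hA.dense_domain hT x)

theorem memLp_orbit (hA : IsInfinitesimalGenerator A T) (hT : IsC0Semigroup T)
    (hP : P.IsPositive) (hc : 0 < c)
    (hL : ∀ x : A.domain, 2 * RCLike.re (inner 𝕜 (A x) (P x)) ≤ -c * ‖(x : H)‖ ^ 2)
    (x : H) : MemLp (fun t : ℝ => T t x) 2 (volume.restrict (Set.Ici (0 : ℝ))) := by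
  have horbit := hT.continuousOn_orbit x
  rw [memLp_two_iff_integrable_sq_norm (horbit.aestronglyMeasurable measurableSet_Ici)]
  change IntegrableOn (fun t : ℝ => ‖T t x‖ ^ 2) (Set.Ici 0)
  rw [integrableOn_Ici_iff_integrableOn_Ioi]
  refine integrableOn_Ioi_of_intervalIntegral_norm_bounded (RCLike.re (inner 𝕜 x (P x)) / c) 0
    (fun n : ℕ => ?_) tendsto_natCast_atTop_atTop (Eventually.of_forall fun n => ?_)
  · exact ((horbit.norm.pow 2).mono Set.Icc_subset_Ici_self).integrableOn_Icc.mono_set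
      Set.Ioc_subset_Icc_self
  · have hle := hA.re_inner_orbit_add_integral_le hT hP hL x n.cast_nonneg
    have hpos := hP.re_inner_nonneg_right (T n x)
    simp only [norm_pow, norm_norm]
    rw [le_div_iff₀' hc]
    linarith

end IsInfinitesimalGenerator

end Dissipation

theorem GeneratesC0Semigroup.isExponentiallyStable_of_lyapunov [CompleteSpace H]
    (hA : GeneratesC0Semigroup A) (hP : P.IsPositive) (hc : 0 < c)
    (hL : ∀ x : A.domain, 2 * RCLike.re (inner 𝕜 (A x) (P x)) ≤ -c * ‖(x : H)‖ ^ 2) :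
    IsExponentiallyStable A := by
  let : NormedSpace ℝ H := NormedSpace.restrictScalars ℝ 𝕜 H
  have : IsScalarTower ℝ 𝕜 H := .restrictScalars ℝ 𝕜 H
  obtain ⟨T, hT, hAT⟩ := hA
  exact ⟨T, hT, hAT, hAT.memLp_orbit hT hP hc hL⟩

theorem IsC0Semigroup.re_inner_gramian_orbit_add_integral [CompleteSpace H] (hT : IsC0Semigroup T)
    (hL2 : ∀ x, MemLp (fun t : ℝ => T t x) 2 (volume.restrict (Set.Ici (0 : ℝ)))) (x : H) {t : ℝ}
    (ht : 0 ≤ t) :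
    RCLike.re (inner 𝕜 (T t x) (gramian T hL2 (T t x))) + ∫ s in (0 : ℝ)..t, ‖T s x‖ ^ 2 =
      RCLike.re (inner 𝕜 x (gramian T hL2 x)) := by
  have hint : IntegrableOn (fun s => ‖T s x‖ ^ 2) (Set.Ioi 0) :=
    IntegrableOn.mono_set ((memLp_two_iff_integrable_sq_norm (hL2 x).1).mp (hL2 x))
      Set.Ioi_subset_Ici_self
  have hshift : ∫ s in Set.Ioi (0 : ℝ), ‖T s (T t x)‖ ^ 2 = ∫ s in Set.Ioi t, ‖T s x‖ ^ 2 := by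
    rw [← (measurePreserving_add_right volume t).setIntegral_preimage_emb
      (measurableEmbedding_addRight t) _ (Set.Ioi t), Set.preimage_add_const_Ioi, sub_self]
    refine setIntegral_congr_fun measurableSet_Ioi fun s hs => ?_
    simp only [hT.map_add_apply (Set.mem_Ioi.mp hs).le ht]
  simp only [re_inner_gramian_self, integral_Ici_eq_integral_Ioi, hshift]
  rw [add_comm, intervalIntegral.integral_interval_add_Ioi hint
    (hint.mono_set (Set.Ioi_subset_Ioi ht))]

theorem IsInfinitesimalGenerator.two_mul_re_inner_gramian [CompleteSpace H] [NormedSpace ℝ H]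
    [IsScalarTower ℝ 𝕜 H] (hA : IsInfinitesimalGenerator A T) (hT : IsC0Semigroup T)
    (hL2 : ∀ x, MemLp (fun t : ℝ => T t x) 2 (volume.restrict (Set.Ici (0 : ℝ)))) (x : A.domain) :
    2 * RCLike.re (inner 𝕜 (A x) (gramian T hL2 x)) = -‖(x : H)‖ ^ 2 := by
  have hform := hasDerivWithinAt_re_inner_of_isPositive (gramian_isPositive T hL2)
    ((hA.mem_graph_iff_hasDerivWithinAt hT).mp (A.mem_graph x))
  have hcont := (hT.continuousOn_orbit (x : H)).norm.pow 2
  have hintegral : HasDerivWithinAt (fun t : ℝ => ∫ s in (0 : ℝ)..t, ‖T s x‖ ^ 2)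
      (‖T 0 x‖ ^ 2) (Set.Ici 0) 0 :=
    intervalIntegral.integral_hasDerivWithinAt_right (t := Set.Ioi 0) .refl
      ((hcont.mono Set.Ioi_subset_Ici_self).stronglyMeasurableAtFilter_nhdsWithin
        measurableSet_Ioi 0)
      ((hcont.continuousWithinAt Set.self_mem_Ici).mono Set.Ioi_subset_Ici_self)
  have hconst := (hasDerivWithinAt_const (0 : ℝ) (Set.Ici 0)
    (RCLike.re (inner 𝕜 (x : H) (gramian T hL2 x)))).congr_of_mem
    (fun t ht => hT.re_inner_gramian_orbit_add_integral hL2 (x : H) ht) Set.self_mem_Ici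
  have hzero := (uniqueDiffWithinAt_Ici (0 : ℝ)).eq_deriv _ (hform.add hintegral) hconst
  rw [hT.map_zero, ContinuousLinearMap.id_apply] at hzero
  exact eq_neg_of_add_eq_zero_left hzero

theorem IsExponentiallyStable.exists_lyapunov_solution [CompleteSpace H]
    (hA : IsExponentiallyStable A) :
    ∃ P : H →L[𝕜] H, P.IsPositive ∧
      ∀ x : A.domain, 2 * RCLike.re (inner 𝕜 (A x) (P x)) = -‖(x : H)‖ ^ 2 := by
  let : NormedSpace ℝ H := NormedSpace.restrictScalars ℝ 𝕜 H
  have : IsScalarTower ℝ 𝕜 H := .restrictScalars ℝ 𝕜 H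
  obtain ⟨T, hT, hAT, hL2⟩ := hA
  exact ⟨gramian T hL2, gramian_isPositive T hL2, hAT.two_mul_re_inner_gramian hT hL2⟩

end Lyapunov

section Detectability

variable {𝕜 : Type*} [RCLike 𝕜] {H : Type*} [NormedAddCommGroup H] [InnerProductSpace 𝕜 H]
  [CompleteSpace H] {Y : Type*} [NormedAddCommGroup Y] [InnerProductSpace 𝕜 Y]
  {A : H →ₗ.[𝕜] H} {C : H →L[𝕜] Y} {P : H →L[𝕜] H}

theorem IsExponentiallyDetectable.exists_isPositive_lyapunovFormInequality
    (h : IsExponentiallyDetectable A C) :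
    ∃ P : H →L[𝕜] H, P.IsPositive ∧ LyapunovFormInequality A C P := by
  obtain ⟨F, hF⟩ := h
  obtain ⟨P, hP, hlyap⟩ := hF.exists_lyapunov_solution
  set K : ℝ := ‖F‖ * ‖P‖
  -- `η` is chosen such that `η - η² K² = η²`.
  obtain ⟨η, hη, hηK⟩ : ∃ η : ℝ, 0 < η ∧ η * (K ^ 2 + 1) = 1 :=
    ⟨(K ^ 2 + 1)⁻¹, by positivity, inv_mul_cancel₀ (by positivity)⟩
  refine ⟨P, hP, η, η ^ 2, hη, by positivity, fun x => ?_⟩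
  set a := RCLike.re (inner 𝕜 (F (C x)) (P x))
  set b := RCLike.re (inner 𝕜 (A x) (P x))
  have hab : 2 * (a + b) = -‖(x : H)‖ ^ 2 := by
    have hx := hlyap x
    rwa [LinearPMap.vadd_apply, inner_add_left, map_add] at hx
  have ha : -(K * ‖C x‖ * ‖(x : H)‖) ≤ a := by
    refine (abs_le.mp ((RCLike.abs_re_le_norm _).trans ((norm_inner_le_norm _ _).trans ?_))).1
    calc ‖F (C x)‖ * ‖P x‖ ≤ (‖F‖ * ‖C x‖) * (‖P‖ * ‖(x : H)‖) := by
          gcongr <;> exact ContinuousLinearMap.le_opNorm _ _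
      _ = K * ‖C x‖ * ‖(x : H)‖ := by ring
  have hsquare : ‖C x‖ ^ 2 - 2 * η * b - η ^ 2 * ‖(x : H)‖ ^ 2 =
      (‖C x‖ - η * K * ‖(x : H)‖) ^ 2 + 2 * η * (K * ‖C x‖ * ‖(x : H)‖ + a) := by
    linear_combination (-η) * hab - η * ‖(x : H)‖ ^ 2 * hηK
  have hcross : 0 ≤ 2 * η * (K * ‖C x‖ * ‖(x : H)‖ + a) :=
    mul_nonneg (by positivity) (by linarith)
  linarith [sq_nonneg (‖C x‖ - η * K * ‖(x : H)‖)]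

theorem LyapunovFormInequality.isExponentiallyDetectable [CompleteSpace Y]
    (hL : LyapunovFormInequality A C P) (hA : GeneratesC0Semigroup A) (hP : P.IsPositive)
    (hran : Set.range (ContinuousLinearMap.adjoint C) ⊆ Set.range P) :
    IsExponentiallyDetectable A C := by
  obtain ⟨η, m, hη, hm, hineq⟩ := hL
  obtain ⟨G, hG⟩ := exists_eq_comp_of_range_subset hran
  refine ⟨((-(1 / (2 * η)) : ℝ) : 𝕜) • G, (hA.vadd _).isExponentiallyStable_of_lyapunov hP
    (div_pos hm hη) fun x => ?_⟩
  have hGC : inner 𝕜 (G (C x)) (P x) = inner 𝕜 (C x) (C x) := by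
    rw [← hP.inner_left_eq_inner_right, ← ContinuousLinearMap.comp_apply, ← hG,
      ContinuousLinearMap.adjoint_inner_left]
  have hfeedback : RCLike.re (inner 𝕜 ((((-(1 / (2 * η)) : ℝ) : 𝕜) • G) (C x)) (P x)) =
      -(1 / (2 * η)) * ‖C x‖ ^ 2 := by
    rw [_root_.smul_apply, inner_smul_left, RCLike.conj_ofReal, RCLike.re_ofReal_mul, hGC,
      inner_self_eq_norm_sq]
  rw [LinearPMap.vadd_apply, inner_add_left, map_add]
  calc 2 * (RCLike.re (inner 𝕜 ((((-(1 / (2 * η)) : ℝ) : 𝕜) • G) (C x)) (P x)) +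
        RCLike.re (inner 𝕜 (A x) (P x)))
      = -(‖C x‖ ^ 2 - 2 * η * RCLike.re (inner 𝕜 (A x) (P x))) / η := by
        rw [hfeedback]
        field_simp
        ring
    _ ≤ -(m * ‖(x : H)‖ ^ 2) / η := by
        gcongr
        exact hineq x
    _ = -(m / η) * ‖(x : H)‖ ^ 2 := by ring

end Detectability

theorem theorem5p2 {𝕜 : Type*} [RCLike 𝕜]
    {H : Type*} [NormedAddCommGroup H] [InnerProductSpace 𝕜 H] [CompleteSpace H]
    {Y : Type*} [NormedAddCommGroup Y] [InnerProductSpace 𝕜 Y] [CompleteSpace Y]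
    (A : H →ₗ.[𝕜] H) (hA : GeneratesC0Semigroup A) (C : H →L[𝕜] Y) :
    (IsExponentiallyDetectable A C →
      ∃ P : H →L[𝕜] H, P.IsPositive ∧ LyapunovFormInequality A C P) ∧
    (∀ P : H →L[𝕜] H, P.IsPositive → LyapunovFormInequality A C P →
      Set.range (ContinuousLinearMap.adjoint C) ⊆ Set.range P →
      IsExponentiallyDetectable A C) :=
  ⟨fun h => h.exists_isPositive_lyapunovFormInequality,
    fun _ hP hL hran => hL.isExponentiallyDetectable hA hP hran⟩
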